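/- Let $\dot x=f(x,u)$ be a smooth ($C^\infty$) control system with $n_x$ states and $n_u$ inputs on an open set $\Omega\subseteq\mathbb R^{n_x}\times\mathbb R^{n_u}$ (local coordinates). **1-flatness.** On the jet space with coordinates $(x,u,\dot u,\ddot u,\dots)$ (product topology) let $\frac{d}{dt}=f(x,u)\,\partial_x+\dot u\,\partial_u+\ddot u\,\partial_{\dot u}+\cdots$. A smooth map $y=y(x,u)$ with $n_u$ components is a *flat output* near a jet $\xi_0=(x_0,u_0,\dot u_0,\ddot u_0,\dots)$ if on a neighbourhood of $\xi_0$ in the jet space (i) the components of $y$ are differentially independent, i.e. the differentials of all the functions $\frac{d^k}{dt^k}y^i$ ($k\ge 0$, $1\le i\le n_u$) are linearly independent at every point, and (ii) $(x,u)=F(y,\dot y,\dots,y^{(r)})$ for some $r$ and some smooth map $F$ defined on an open set. The system is *1-flat* near $\xi_0$ if it has such a flat output depending on $x$ and $u$ only. **Implicit triangular form.** Let $m=n_b+1$ and let $z=(z^1,\dots,z^m)$ be coordinates with blocks $z^i=(y^i,\hat z^i)$, $n_{z^i}=n_{y^i}+n_{\hat z^i}$, where $z^1=y^1$, $z^m=\hat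 z^m$ and any of the sub-blocks may be empty. The equations $\Xi^i_e=0$, $i=1,\dots,n_b$, with $$\Xi^i_e=\sum_{k=1}^{i}a^i_k\,\dot z^k-b^i ,$$ are in implicit triangular form at a point $(z_0,\dot z_0)$ if $\dim\Xi^i_e=\dim\hat z^{i+1}$, the entries of $a^i_k$ and $b^i$ are smooth functions of $(z^1,\dots,z^i,\hat z^{i+1})$ only, and the square Jacobian matrices $[\partial_{\hat z^{i+1}}\Xi^i_e]$ are regular at $(z_0,\dot z_0)$ for all $i=1,\dots,n_b$. **Proposition.** Let $\xi_0=(x_0,u_0,\dot u_0,\ddot u_0,\dots)$ be a jet with $(x_0,u_0)\in\Omega$. Suppose there is a diffeomorphism $(x,u)=\varphi(z^1,\dots,z^m)$ from an open set of $z$-space onto a neighbourhood of $(x_0,u_0)$ contained in $\Omega$, with $\sum_{i=1}^m n_{z^i}=n_x+n_u$, in whose coordinates the system is represented by equations $\Xi^1_e=0,\dots,\Xi^{n_b}_e=0$ as above (that is, for every $z$ in the domain of $\varphi$, a velocity $\dot z$ satisfies all of them if and only if the $x$-component of $D\varphi(z)\dot z$ equals $f(\varphi(z))$). Suppose that these equations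 are in implicit triangular form at $(z_0,\dot z_0)$, where $z_0=\varphi^{-1}(x_0,u_0)$ and $\dot z_0=D\varphi^{-1}(x_0,u_0)\,(f(x_0,u_0),\dot u_0)$, and that $\sum_{i=1}^{m-1}n_{y^i}=n_u$. Then the system is 1-flat near $\xi_0$. More precisely, $(y^1,\dots,y^{m-1})$, read as a function of $(x,u)$ through $\varphi^{-1}$, is a flat output near $\xi_0$. -/

import Mathlib

open scoped ContDiff

noncomputable section

namespace ControlFlat

/-! ### Control systems and jets of the input -/

/-- The local coordinate space of the pairs `(x, u)`. -/
abbrev StateInput (nx nu : ℕ) : Type := (Fin nx → ℝ) × (Fin nu → ℝ)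

/-- The jet space with coordinates `(x, u, u', u'', …)`; `ξ.2 k` is the `k`-th time derivative
of the input. It carries the product topology, so a neighbourhood of a jet restricts only
finitely many of the derivatives of `u`. -/
abbrev Jet (nx nu : ℕ) : Type := (Fin nx → ℝ) × (ℕ → Fin nu → ℝ)

/-- The point `(x, u)` below a jet `(x, u, u', …)`. -/
def Jet.base {nx nu : ℕ} (ξ : Jet nx nu) : StateInput nx nu := (ξ.1, ξ.2 0)

/-- The velocity `(f(x,u), u', u'', u''', …)` of a jet along the trajectories of `x' = f(x,u)`. -/
def cartanField {nx nu : ℕ} (f : StateInput nx nu → Fin nx → ℝ) (ξ : Jet nx nu) : Jet nx nu :=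
  (f (Jet.base ξ), fun k => ξ.2 (k + 1))

/-- Total time derivative of a function on the jet space along `x' = f(x,u)`: the derivative in
the direction `f(x,u) ∂_x + u' ∂_u + u'' ∂_{u'} + …`. -/
def totalDeriv {nx nu : ℕ} (f : StateInput nx nu → Fin nx → ℝ) (g : Jet nx nu → ℝ) :
    Jet nx nu → ℝ :=
  fun ξ => lineDeriv ℝ g ξ (cartanField f ξ)

/-- The `k`-th time derivative of the component `y^i = h^i(x,u)` along `x' = f(x,u)`, as a
function on the jet space. -/
def outputDeriv {nx nu : ℕ} {ι : Type} (f : StateInput nx nu → Fin nx → ℝ)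
    (h : StateInput nx nu → ι → ℝ) (k : ℕ) (i : ι) : Jet nx nu → ℝ :=
  (totalDeriv f)^[k] (fun ξ => h (Jet.base ξ) i)

/-- The functions `y^i = h^i(x,u)` are differentially independent at the jet `ξ`: the
differentials at `ξ` of all the time derivatives of all the `y^i` are linearly independent. -/
def DifferentiallyIndependentAt {nx nu : ℕ} {ι : Type} (f : StateInput nx nu → Fin nx → ℝ)
    (h : StateInput nx nu → ι → ℝ) (ξ : Jet nx nu) : Prop :=
  LinearIndependent ℝ
    (fun (p : ℕ × ι) (v : Jet nx nu) => lineDeriv ℝ (outputDeriv f h p.1 p.2) ξ v)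

/-- `y = h(x,u)` is a flat output of `x' = f(x,u)` near the jet `ξ₀`: it consists of `n_u` smooth
functions which, on a neighbourhood of `ξ₀` in the jet space, are differentially independent and
parameterize `(x,u)` smoothly through `y` and finitely many of its time derivatives. -/
structure IsFlatOutputAt {nx nu : ℕ} {ι : Type} [Fintype ι] (f : StateInput nx nu → Fin nx → ℝ)
    (h : StateInput nx nu → ι → ℝ) (ξ₀ : Jet nx nu) : Prop where
  card_eq : Fintype.card ι = nu
  smooth : ∃ W : Set (StateInput nx nu), IsOpen W ∧ Jet.base ξ₀ ∈ W ∧ ContDiffOn ℝ ∞ h W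
  flat : ∃ N : Set (Jet nx nu), IsOpen N ∧ ξ₀ ∈ N ∧
    (∀ ξ ∈ N, DifferentiallyIndependentAt f h ξ) ∧
    ∃ (r : ℕ) (V : Set (Fin (r + 1) → ι → ℝ)) (F : (Fin (r + 1) → ι → ℝ) → StateInput nx nu),
      IsOpen V ∧ ContDiffOn ℝ ∞ F V ∧
      ∀ ξ ∈ N, (fun (k : Fin (r + 1)) (i : ι) => outputDeriv f h k i ξ) ∈ V ∧
        F (fun (k : Fin (r + 1)) (i : ι) => outputDeriv f h k i ξ) = Jet.base ξ

/-- `x' = f(x,u)` is 1-flat near the jet `ξ₀`: it has a flat output that is a function of `x`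
and `u` only. -/
def IsOneFlatAt {nx nu : ℕ} (f : StateInput nx nu → Fin nx → ℝ) (ξ₀ : Jet nx nu) : Prop :=
  ∃ h : StateInput nx nu → Fin nu → ℝ, IsFlatOutputAt f h ξ₀

/-! ### The implicit triangular form -/

/-- The partition `z = (z^1, …, z^m)`, `m = n_b + 1`, with `z^i = (y^i, ẑ^i)`, where `z^1 = y^1`
and `z^m = ẑ^m`. Blocks are numbered from `0`: the block `i : Fin (nb + 1)` is `z^{i+1}`, with
`ny i` coordinates `y` and `nh i` coordinates `ẑ`. -/
structure BlockPartition where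
  nb : ℕ
  ny : Fin (nb + 1) → ℕ
  nh : Fin (nb + 1) → ℕ
  nh_first : nh 0 = 0
  ny_last : ny (Fin.last nb) = 0

/-- Dimension of the block `z^{i+1}`. -/
def BlockPartition.nz (B : BlockPartition) (i : Fin (B.nb + 1)) : ℕ := B.ny i + B.nh i

/-- Indices of all the `z`-coordinates: a block, and in it a `y`- or a `ẑ`-coordinate. -/
abbrev BlockPartition.Index (B : BlockPartition) : Type :=
  Σ i : Fin (B.nb + 1), Fin (B.ny i) ⊕ Fin (B.nh i)

/-- Indices of all the `y`-coordinates. -/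
abbrev BlockPartition.YIndex (B : BlockPartition) : Type :=
  Σ i : Fin (B.nb + 1), Fin (B.ny i)

/-- The coordinate space of `z`. -/
abbrev BlockPartition.Coord (B : BlockPartition) : Type := B.Index → ℝ

/-- The `z`-coordinates belonging to `y = (y^1, …, y^{m-1})`. -/
def BlockPartition.yPart (B : BlockPartition) (z : B.Coord) : B.YIndex → ℝ :=
  fun p => z ⟨p.1, Sum.inl p.2⟩

/-- The coordinates on which the coefficients of the `i`-th block of equations may depend: with
one-based numbering of blocks, `z^1, …, z^i` and `ẑ^{i+1}`. -/
def BlockPartition.Allowed (B : BlockPartition) (i : Fin B.nb) : B.Index → Prop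
  | ⟨k, Sum.inl _⟩ => k ≤ i.castSucc
  | ⟨k, Sum.inr _⟩ => k ≤ i.succ

/-- The coefficients, smooth on a set `Z`, of implicit differential equations
`a^i_1 ż^1 + … + a^i_i ż^i - b^i = 0`, `i = 1, …, n_b`, of triangular shape. The block `i` has
as many equations as `ẑ^{i+1}` has coordinates, and its coefficients are functions of
`z^1, …, z^i, ẑ^{i+1}` only. -/
structure TriangularEquations (B : BlockPartition) (Z : Set B.Coord) where
  a : (i : Fin B.nb) → Fin (B.nh i.succ) → B.Index → B.Coord → ℝ
  b : (i : Fin B.nb) → Fin (B.nh i.succ) → B.Coord → ℝ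
  a_smooth : ∀ i j κ, ContDiffOn ℝ ∞ (a i j κ) Z
  b_smooth : ∀ i j, ContDiffOn ℝ ∞ (b i j) Z
  a_dep : ∀ i j κ, ∀ z ∈ Z, ∀ z' ∈ Z, (∀ l, B.Allowed i l → z l = z' l) → a i j κ z = a i j κ z'
  b_dep : ∀ i j, ∀ z ∈ Z, ∀ z' ∈ Z, (∀ l, B.Allowed i l → z l = z' l) → b i j z = b i j z'

/-- The left-hand side `Ξ^{i,j}(z, ż)` of the `j`-th equation of the `i`-th block. Only the
velocities of the blocks `z^1, …, z^i` occur. -/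
def TriangularEquations.lhs {B : BlockPartition} {Z : Set B.Coord} (T : TriangularEquations B Z)
    (i : Fin B.nb) (j : Fin (B.nh i.succ)) (z zdot : B.Coord) : ℝ :=
  (∑ κ : B.Index, if κ.1 ≤ i.castSucc then T.a i j κ z * zdot κ else 0) - T.b i j z

/-- The Jacobian matrix `[∂Ξ^i / ∂ẑ^{i+1}]` at `(z, ż)`, with `ż` held fixed. -/
def TriangularEquations.jacobian {B : BlockPartition} {Z : Set B.Coord}
    (T : TriangularEquations B Z) (i : Fin B.nb) (z zdot : B.Coord) :
    Matrix (Fin (B.nh i.succ)) (Fin (B.nh i.succ)) ℝ :=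
  Matrix.of fun j l =>
    fderiv ℝ (fun w => T.lhs i j w zdot) z (Pi.single ⟨i.succ, Sum.inr l⟩ 1)

/-- The regularity condition of the implicit triangular form at `(z, ż)`. -/
def TriangularEquations.RegularAt {B : BlockPartition} {Z : Set B.Coord}
    (T : TriangularEquations B Z) (z zdot : B.Coord) : Prop :=
  ∀ i : Fin B.nb, (T.jacobian i z zdot).det ≠ 0

/-- In the coordinates `(x,u) = φ(z)` the system `x' = f(x,u)` is represented by the equations
`T`: a velocity `ż` at `z` solves `T` if and only if it is a velocity of the system. -/
def Represents {nx nu : ℕ} {B : BlockPartition} {Z : Set B.Coord} (T : TriangularEquations B Z)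
    (φ : B.Coord → StateInput nx nu) (f : StateInput nx nu → Fin nx → ℝ) : Prop :=
  ∀ z ∈ Z, ∀ zdot : B.Coord,
    (∀ i j, T.lhs i j z zdot = 0) ↔ (fderiv ℝ φ z zdot).1 = f (φ z)

end ControlFlat

end

/-!
By the implicit function theorem, the `i`-th block of equations determines `ẑ^{i+1}` from
`z^1, …, z^i` and their velocities. Solving the blocks one after the other expresses `z`, and with
it `(x, u)`, as a smooth function of finitely many time derivatives of `y`, where `y` is arbitrary:
the time derivative on the space of sequences `(y, y', y'', …)` is the shift. Differentiating `u`
along the shift lifts this function to a map from sequences to jets, which carries the shift to the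
velocity field `cartanField f` because all the equations are solved. The lift is therefore inverse
to the map from a jet to its sequence of output derivatives. The output derivatives composed with
it are the coordinates on the space of sequences, which gives their independence.
-/

noncomputable section

namespace ControlFlat

open Filter Topology

/-! ### Calculus on spaces of infinite jets -/

universe u

section Velocity

variable {J J' : Type*} [AddCommGroup J] [Module ℝ J] [TopologicalSpace J]
  [AddCommGroup J'] [Module ℝ J'] [TopologicalSpace J']

/-- The curve `c` has velocity `v` at time `t`. Unlike for `HasDerivAt`, the limit of the difference
quotients is taken in an arbitrary topological vector space, such as a space of jets. -/
def HasVelocityAt (c : ℝ → J) (v : J) (t : ℝ) : Prop :=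
  Tendsto (slope c t) (𝓝[≠] t) (𝓝 v)

theorem hasVelocityAt_iff_hasDerivAt {F : Type*} [NormedAddCommGroup F] [NormedSpace ℝ F]
    {c : ℝ → F} {v : F} {t : ℝ} : HasVelocityAt c v t ↔ HasDerivAt c v t :=
  hasDerivAt_iff_tendsto_slope.symm

theorem hasVelocityAt_pi {ι : Type*} {V : ι → Type*} [∀ i, AddCommGroup (V i)]
    [∀ i, Module ℝ (V i)] [∀ i, TopologicalSpace (V i)] {c : ℝ → ∀ i, V i} {v : ∀ i, V i} {t : ℝ} :
    HasVelocityAt c v t ↔ ∀ i, HasVelocityAt (fun s => c s i) (v i) t :=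
  tendsto_pi_nhds

theorem hasVelocityAt_line (p v : J) :
    HasVelocityAt (fun t : ℝ => p + t • v) v 0 := by
  refine tendsto_const_nhds.congr' ?_
  filter_upwards [self_mem_nhdsWithin] with t (ht : t ≠ 0)
  simp [slope_def_module, smul_smul, ht]

namespace HasVelocityAt

variable {c : ℝ → J} {v : J} {t : ℝ}

theorem prodMk {c' : ℝ → J'} {v' : J'} (hc : HasVelocityAt c v t) (hc' : HasVelocityAt c' v' t) :
    HasVelocityAt (fun s => (c s, c' s)) (v, v') t :=
  Tendsto.prodMk_nhds hc hc'

theorem clm_comp (hc : HasVelocityAt c v t) (L : J →L[ℝ] J') :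
    HasVelocityAt (L ∘ c) (L v) t := by
  refine ((L.continuous.tendsto v).comp hc).congr fun s => ?_
  simp [slope_def_module]

theorem continuousAt [ContinuousAdd J] [ContinuousSMul ℝ J] (hc : HasVelocityAt c v t) :
    ContinuousAt c t := by
  rw [← continuousWithinAt_compl_self]
  have hsub : Tendsto (fun s => s - t) (𝓝[≠] t) (𝓝 0) := by
    have : Continuous fun s => s - t := by fun_prop
    simpa using (this.tendsto t).mono_left nhdsWithin_le_nhds
  have hadd : Tendsto (fun s => (s - t) • slope c t s + c t) (𝓝[≠] t) (𝓝 (c t)) := by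
    simpa using (hsub.smul hc).add_const (c t)
  exact hadd.congr fun s => by simp

end HasVelocityAt

theorem lineDeriv_clm {F : Type*} [NormedAddCommGroup F] [NormedSpace ℝ F]
    (L : J →L[ℝ] F) (p v : J) : lineDeriv ℝ L p v = L v :=
  (hasVelocityAt_iff_hasDerivAt.1 ((hasVelocityAt_line p v).clm_comp L)).deriv

end Velocity

section SmoothNear

variable {J F F' : Type u} [AddCommGroup J] [Module ℝ J] [TopologicalSpace J]
  [NormedAddCommGroup F] [NormedSpace ℝ F] [NormedAddCommGroup F'] [NormedSpace ℝ F']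

/-- Near `p`, the function `g` is a smooth function of a continuous linear image of its argument in
a normed space; on a space of sequences, this is a smooth function of finitely many terms.
Smoothness is required in a neighbourhood because `ContDiffAt ℝ ∞` at a single point does not
give one on which all the derivatives exist. -/
def SmoothNear (g : J → F) (p : J) : Prop :=
  ∃ (E : Type u) (_ : NormedAddCommGroup E) (_ : NormedSpace ℝ E) (L : J →L[ℝ] E) (G : E → F),
    (∀ᶠ e in 𝓝 (L p), ContDiffAt ℝ ∞ G e) ∧ g =ᶠ[𝓝 p] G ∘ L

/-- The derivative of `g` along the vector field `X`. -/
def derivAlong (X : J → J) (g : J → F) (p : J) : F :=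
  lineDeriv ℝ g p (X p)

/-- Near `p`, every continuous linear image in a normed space of the vector field `X` is smooth. -/
def SmoothFieldNear (X : J → J) (p : J) : Prop :=
  ∀ ⦃E : Type u⦄ [NormedAddCommGroup E] [NormedSpace ℝ E] (L : J →L[ℝ] E), SmoothNear (L ∘ X) p

namespace SmoothNear

variable {g : J → F} {p : J}

theorem eventually (hg : SmoothNear g p) : ∀ᶠ q in 𝓝 p, SmoothNear g q := by
  obtain ⟨E, _, _, L, G, hG, hgG⟩ := hg
  filter_upwards [L.continuous.continuousAt.eventually hG.eventually_nhds, hgG.eventually_nhds]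
    with q hq hgq
  exact ⟨E, _, _, L, G, hq, hgq⟩

theorem congr {g' : J → F} (hg : SmoothNear g p) (h : g' =ᶠ[𝓝 p] g) : SmoothNear g' p := by
  obtain ⟨E, _, _, L, G, hG, hgG⟩ := hg
  exact ⟨E, _, _, L, G, hG, h.trans hgG⟩

theorem clm (L : J →L[ℝ] F) (p : J) : SmoothNear L p :=
  ⟨F, _, _, L, id, .of_forall fun _ => contDiffAt_id, .rfl⟩

theorem continuousAt (hg : SmoothNear g p) : ContinuousAt g p := by
  obtain ⟨E, _, _, L, G, hG, hgG⟩ := hg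
  exact (hG.self_of_nhds.continuousAt.comp L.continuous.continuousAt).congr hgG.symm

theorem comp {H : F → F'} (hg : SmoothNear g p) (hH : ∀ᶠ y in 𝓝 (g p), ContDiffAt ℝ ∞ H y) :
    SmoothNear (H ∘ g) p := by
  obtain ⟨E, _, _, L, G, hG, hgG⟩ := hg
  rw [hgG.eq_of_nhds] at hH
  refine ⟨E, _, _, L, H ∘ G, ?_, hgG.fun_comp H⟩
  filter_upwards [hG, hG.self_of_nhds.continuousAt.eventually hH] with e hGe hHe
  exact hHe.comp e hGe

theorem comp_contDiff {H : F → F'} (hg : SmoothNear g p) (hH : ContDiff ℝ ∞ H) :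
    SmoothNear (H ∘ g) p :=
  hg.comp (.of_forall fun _ => hH.contDiffAt)

theorem prodMk {g' : J → F'} (hg : SmoothNear g p) (hg' : SmoothNear g' p) :
    SmoothNear (fun q => (g q, g' q)) p := by
  obtain ⟨E, _, _, L, G, hG, hgG⟩ := hg
  obtain ⟨E', _, _, L', G', hG', hgG'⟩ := hg'
  refine ⟨E × E', _, _, L.prod L', Prod.map G G', ?_, hgG.prodMk hgG'⟩
  filter_upwards [hG.prod_nhds hG'] with e he
  exact he.1.prodMap' he.2

theorem apply {ι : Type} [Fintype ι] {g : J → ι → F} (hg : SmoothNear g p) (i : ι) :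
    SmoothNear (fun q => g q i) p :=
  hg.comp_contDiff (contDiff_apply ℝ F i)

end SmoothNear

variable [ContinuousAdd J] [ContinuousSMul ℝ J]

theorem HasVelocityAt.comp_hasFDerivAt {E : Type*} [NormedAddCommGroup E] [NormedSpace ℝ E]
    {L : J →L[ℝ] E} {G : E → F} {G' : E →L[ℝ] F} {g : J → F} {c : ℝ → J} {v : J} {t : ℝ}
    (hc : HasVelocityAt c v t) (hG : HasFDerivAt G G' (L (c t))) (hg : g =ᶠ[𝓝 (c t)] G ∘ L) :
    HasDerivAt (g ∘ c) (G' (L v)) t :=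
  (hG.comp_hasDerivAt t (hasVelocityAt_iff_hasDerivAt.1 (hc.clm_comp L))).congr_of_eventuallyEq
    (hg.comp_tendsto hc.continuousAt)

theorem lineDeriv_eq_fderiv_apply {E : Type*} [NormedAddCommGroup E] [NormedSpace ℝ E]
    {L : J →L[ℝ] E} {G : E → F} {g : J → F} {p : J} (hG : DifferentiableAt ℝ G (L p))
    (hg : g =ᶠ[𝓝 p] G ∘ L) (v : J) : lineDeriv ℝ g p v = fderiv ℝ G (L p) (L v) := by
  have hline := hasVelocityAt_line p v
  exact (hline.comp_hasFDerivAt (by simpa using hG.hasFDerivAt) (by simpa using hg)).deriv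

theorem HasVelocityAt.comp_smoothNear {g : J → F} {c : ℝ → J} {v : J} {t : ℝ}
    (hc : HasVelocityAt c v t) (hg : SmoothNear g (c t)) :
    HasDerivAt (g ∘ c) (lineDeriv ℝ g (c t) v) t := by
  obtain ⟨E, _, _, L, G, hG, hgG⟩ := hg
  have hdiff : DifferentiableAt ℝ G (L (c t)) := hG.self_of_nhds.differentiableAt (by simp)
  rw [lineDeriv_eq_fderiv_apply hdiff hgG]
  exact hc.comp_hasFDerivAt hdiff.hasFDerivAt hgG

theorem SmoothNear.hasLineDerivAt {g : J → F} {p : J} (hg : SmoothNear g p) (v : J) :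
    HasLineDerivAt ℝ g (lineDeriv ℝ g p v) p v := by
  have hg₀ : SmoothNear g (p + (0 : ℝ) • v) := by simpa using hg
  simpa [HasLineDerivAt, Function.comp_def] using (hasVelocityAt_line p v).comp_smoothNear hg₀

theorem SmoothNear.derivAlong_apply {ι : Type} [Fintype ι] {g : J → ι → F} {p : J}
    (hg : SmoothNear g p) (X : J → J) (i : ι) :
    derivAlong X g p i = derivAlong X (fun q => g q i) p :=
  (hasDerivAt_pi.1 (hg.hasLineDerivAt (X p)) i).deriv.symm

theorem SmoothNear.derivAlong_comp {X : J → J} {g : J → F} {p : J} {H : F → F'}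
    (hg : SmoothNear g p) (hH : DifferentiableAt ℝ H (g p)) :
    derivAlong X (H ∘ g) p = fderiv ℝ H (g p) (derivAlong X g p) := by
  have hline := hg.hasLineDerivAt (X p)
  exact (hH.hasFDerivAt.comp_hasDerivAt_of_eq (0 : ℝ) hline (by simp)).deriv

theorem SmoothNear.derivAlong {X : J → J} {g : J → F} {p : J} (hg : SmoothNear g p)
    (hX : SmoothFieldNear X p) : SmoothNear (derivAlong X g) p := by
  obtain ⟨E, _, _, L, G, hG, hgG⟩ := hg
  have hsmooth : ∀ᶠ e : E × E in 𝓝 (L p, (L ∘ X) p),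
      ContDiffAt ℝ ∞ (fun e : E × E => fderiv ℝ G e.1 e.2) e := by
    filter_upwards [continuous_fst.continuousAt.eventually hG] with e he
    have hfderiv : ContDiffAt ℝ ∞ (fderiv ℝ G) e.1 := he.fderiv_right (by simp)
    exact (hfderiv.comp e contDiffAt_fst).clm_apply contDiffAt_snd
  refine (((SmoothNear.clm L p).prodMk (hX L)).comp hsmooth).congr ?_
  filter_upwards [L.continuous.continuousAt.eventually hG, hgG.eventually_nhds] with q hGq hgq
  exact lineDeriv_eq_fderiv_apply (hGq.differentiableAt (by simp)) hgq (X q)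

theorem SmoothNear.iterate_derivAlong {X : J → J} {g : J → F} {p : J} (hg : SmoothNear g p)
    (hX : SmoothFieldNear X p) (k : ℕ) : SmoothNear ((ControlFlat.derivAlong X)^[k] g) p := by
  induction k with
  | zero => exact hg
  | succ k ih => rw [Function.iterate_succ_apply']; exact ih.derivAlong hX

theorem derivAlong_congr {g g' : J → F} {p : J} (h : g =ᶠ[𝓝 p] g') (X : J → J) :
    derivAlong X g =ᶠ[𝓝 p] derivAlong X g' := by
  filter_upwards [h.eventually_nhds] with q hq
  have hline : Tendsto (fun t : ℝ => q + t • X q) (𝓝 0) (𝓝 q) := by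
    simpa using (hasVelocityAt_line q (X q)).continuousAt.tendsto
  exact EventuallyEq.deriv_eq (hline.eventually hq)

theorem iterate_derivAlong_congr {g g' : J → F} {p : J} (h : g =ᶠ[𝓝 p] g') (X : J → J) (k : ℕ) :
    (derivAlong X)^[k] g =ᶠ[𝓝 p] (derivAlong X)^[k] g' := by
  induction k with
  | zero => exact h
  | succ k ih => simpa only [Function.iterate_succ_apply'] using derivAlong_congr ih X

end SmoothNear

section RelatedFields

variable {J J' F : Type u} [AddCommGroup J] [Module ℝ J] [AddCommGroup J'] [Module ℝ J']
  [TopologicalSpace J'] [NormedAddCommGroup F] [NormedSpace ℝ F]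

/-- The map `Φ` carries the vector field `X` at `p` to the vector field `X'` at `Φ p`. -/
def IsRelatedAt (Φ : J → J') (X : J → J) (X' : J' → J') (p : J) : Prop :=
  HasVelocityAt (fun t : ℝ => Φ (p + t • X p)) (X' (Φ p)) 0

variable [ContinuousAdd J'] [ContinuousSMul ℝ J']

theorem IsRelatedAt.hasLineDerivAt_comp {Φ : J → J'} {X : J → J} {X' : J' → J'} {p : J}
    (hΦ : IsRelatedAt Φ X X' p) {g : J' → F} (hg : SmoothNear g (Φ p)) :
    HasLineDerivAt ℝ (g ∘ Φ) (derivAlong X' g (Φ p)) p (X p) := by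
  have hg₀ : SmoothNear g (Φ (p + (0 : ℝ) • X p)) := by simpa using hg
  simpa [derivAlong, HasLineDerivAt, Function.comp_def] using hΦ.comp_smoothNear hg₀

theorem IsRelatedAt.derivAlong_comp {Φ : J → J'} {X : J → J} {X' : J' → J'} {p : J}
    (hΦ : IsRelatedAt Φ X X' p) {g : J' → F} (hg : SmoothNear g (Φ p)) :
    derivAlong X (g ∘ Φ) p = derivAlong X' g (Φ p) :=
  (hΦ.hasLineDerivAt_comp hg).lineDeriv

theorem iterate_derivAlong_comp_eventuallyEq [TopologicalSpace J] [ContinuousAdd J]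
    [ContinuousSMul ℝ J] {Φ : J → J'} {X : J → J} {X' : J' → J'} {p : J}
    (hΦ : ∀ᶠ q in 𝓝 p, IsRelatedAt Φ X X' q) (hΦp : ContinuousAt Φ p)
    (hX' : SmoothFieldNear X' (Φ p)) {g : J' → F} (hg : SmoothNear g (Φ p)) (k : ℕ) :
    (derivAlong X)^[k] (g ∘ Φ) =ᶠ[𝓝 p] (derivAlong X')^[k] g ∘ Φ := by
  induction k with
  | zero => rfl
  | succ k ih =>
    simp only [Function.iterate_succ_apply']
    refine (derivAlong_congr ih X).trans ?_
    filter_upwards [hΦ, hΦp.eventually (hg.iterate_derivAlong hX' k).eventually] with q hq hgq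
    exact hq.derivAlong_comp hgq

end RelatedFields

section Sequences

variable {V : Type*} [AddCommGroup V] [Module ℝ V] [TopologicalSpace V]

variable (V) in
/-- The shift of sequences, which is the total time derivative on the jets `(y, y', y'', …)` of
unconstrained curves. -/
def seqShift : (ℕ → V) →L[ℝ] (ℕ → V) :=
  Pi.compRightL ℝ (fun _ => V) Nat.succ

variable (V) in
/-- The restriction of a sequence to its terms up to the index `r`. -/
def truncation (r : ℕ) : (ℕ → V) →L[ℝ] (Fin (r + 1) → V) :=
  Pi.compRightL ℝ (fun _ => V) Fin.val

theorem exists_eq_zero_of_forall_le {E : Type*} [NormedAddCommGroup E] [NormedSpace ℝ E]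
    (L : (ℕ → V) →L[ℝ] E) : ∃ r, ∀ y : ℕ → V, (∀ k ≤ r, y k = 0) → L y = 0 := by
  have hball : L ⁻¹' Metric.ball 0 1 ∈ 𝓝 (0 : ℕ → V) :=
    L.continuous.continuousAt.preimage_mem_nhds (by simpa using Metric.ball_mem_nhds _ one_pos)
  rw [nhds_pi, Filter.mem_pi] at hball
  obtain ⟨I, hI, t, ht, hsub⟩ := hball
  obtain ⟨r, hr⟩ := hI.bddAbove
  refine ⟨r, fun y hy => by_contra fun hne => ?_⟩
  have hmem : ‖L y‖⁻¹ • y ∈ I.pi t := fun k hk => by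
    simpa [hy k (hr hk)] using mem_of_mem_nhds (ht k)
  have hlt := hsub hmem
  simp [norm_smul, norm_ne_zero_iff.2 hne] at hlt

theorem exists_eq_comp_truncation {E : Type*} [NormedAddCommGroup E] [NormedSpace ℝ E]
    (L : (ℕ → V) →L[ℝ] E) :
    ∃ (r : ℕ) (L' : (Fin (r + 1) → V) →L[ℝ] E), L = L' ∘L truncation V r := by
  obtain ⟨r, hr⟩ := exists_eq_zero_of_forall_le L
  let extendByZero : (Fin (r + 1) → V) →L[ℝ] (ℕ → V) := ContinuousLinearMap.pi fun k =>
    if hk : k ≤ r then ContinuousLinearMap.proj ⟨k, Nat.lt_succ_of_le hk⟩ else 0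
  refine ⟨r, L ∘L extendByZero, ContinuousLinearMap.ext fun y => sub_eq_zero.1 ?_⟩
  rw [ContinuousLinearMap.comp_apply, ContinuousLinearMap.comp_apply, ← map_sub]
  refine hr _ fun k hk => ?_
  simp [extendByZero, truncation, hk]

theorem SmoothNear.exists_eventuallyEq_comp_truncation {V F : Type u} [NormedAddCommGroup V]
    [NormedSpace ℝ V] [NormedAddCommGroup F] [NormedSpace ℝ F] {g : (ℕ → V) → F} {Y₀ : ℕ → V}
    (hg : SmoothNear g Y₀) :
    ∃ (r : ℕ) (G : (Fin (r + 1) → V) → F),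
      (∀ᶠ y in 𝓝 (truncation V r Y₀), ContDiffAt ℝ ∞ G y) ∧ g =ᶠ[𝓝 Y₀] G ∘ truncation V r := by
  obtain ⟨E, _, _, L, G, hG, hgG⟩ := hg
  obtain ⟨r, L', rfl⟩ := exists_eq_comp_truncation L
  refine ⟨r, G ∘ L', ?_, hgG⟩
  filter_upwards [L'.continuous.continuousAt.eventually hG] with y hy
  exact hy.comp y L'.contDiff.contDiffAt

theorem smoothFieldNear_clm {J : Type*} [AddCommGroup J] [Module ℝ J] [TopologicalSpace J]
    (A : J →L[ℝ] J) (p : J) : SmoothFieldNear A p :=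
  fun _ _ _ L => .clm (L ∘L A) p

end Sequences

section ImplicitFunction

variable {𝕜 E₁ E₂ F : Type*} [RCLike 𝕜] [NormedAddCommGroup E₁] [NormedSpace 𝕜 E₁]
  [NormedAddCommGroup E₂] [NormedSpace 𝕜 E₂] [CompleteSpace E₂]
  [NormedAddCommGroup F] [NormedSpace 𝕜 F]

theorem eventually_isInvertible_fderiv_comp_inr {Ψ : E₁ × E₂ → F} {u : E₁ × E₂}
    {n : WithTop ℕ∞} (hn : n ≠ 0) (hΨ : ContDiffAt 𝕜 n Ψ u)
    (hinv : (fderiv 𝕜 Ψ u ∘L .inr 𝕜 E₁ E₂).IsInvertible) :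
    ∀ᶠ q in 𝓝 u, (fderiv 𝕜 Ψ q ∘L .inr 𝕜 E₁ E₂).IsInvertible := by
  have hcont : ContinuousAt (fun q => fderiv 𝕜 Ψ q ∘L .inr 𝕜 E₁ E₂) u :=
    (hΨ.continuousAt_fderiv hn).clm_comp continuousAt_const
  obtain ⟨e, he⟩ := hinv
  rw [ContinuousAt, ← he] at hcont
  exact hcont.eventually (ContinuousLinearEquiv.nhds e)

theorem eventually_contDiffAt_implicitFunction [CompleteSpace E₁] [CompleteSpace F]
    {Ψ : E₁ × E₂ → F} {u : E₁ × E₂} {n : WithTop ℕ∞}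
    (hn : n ≠ 0) (hΨ : ∀ᶠ q in 𝓝 u, ContDiffAt 𝕜 n Ψ q)
    (hinv : (fderiv 𝕜 Ψ u ∘L .inr 𝕜 E₁ E₂).IsInvertible) :
    ∀ᶠ p in 𝓝 u.1, ContDiffAt 𝕜 n (hΨ.self_of_nhds.implicitFunction hn hinv) p := by
  have hu := hΨ.self_of_nhds
  set ψ := hu.implicitFunction hn hinv
  have hgraph : Tendsto (fun p => (p, ψ p)) (𝓝 u.1) (𝓝 u) := by
    have hψ : ContinuousAt ψ u.1 := (hu.contDiffAt_implicitFunction hn hinv).continuousAt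
    simpa [ψ, hu.implicitFunction_apply_self hn hinv] using (continuousAt_id.prodMk hψ).tendsto
  have hunique : ∀ᶠ q in 𝓝 u, Ψ q = Ψ u ↔ ψ q.1 = q.2 :=
    hu.eventually_apply_eq_iff_implicitFunction hn hinv
  filter_upwards [hu.eventually_apply_implicitFunction hn hinv, hgraph.eventually hΨ,
    hgraph.eventually hunique.eventually_nhds,
    hgraph.eventually (eventually_isInvertible_fderiv_comp_inr hn hu hinv)]
    with p hψp hΨp huniquep hinvp
  have hχ : ContDiffAt 𝕜 n (hΨp.implicitFunction hn hinvp) p :=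
    hΨp.contDiffAt_implicitFunction hn hinvp
  have hχp : hΨp.implicitFunction hn hinvp p = ψ p := hΨp.implicitFunction_apply_self hn hinvp
  have hχgraph : Tendsto (fun p' => (p', hΨp.implicitFunction hn hinvp p')) (𝓝 p)
      (𝓝 (p, ψ p)) := by
    simpa [hχp] using (continuousAt_id.prodMk hχ.continuousAt).tendsto
  refine hχ.congr_of_eventuallyEq ?_
  filter_upwards [hχgraph.eventually huniquep, hΨp.eventually_apply_implicitFunction hn hinvp]
    with p' huniquep' hχp'
  exact huniquep'.1 (hχp'.trans hψp)

end ImplicitFunction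

section Coordinates

variable {J : Type} [AddCommGroup J] [Module ℝ J] [TopologicalSpace J]

theorem iterate_derivAlong_clm {X : J → J} {c : ℕ → J →L[ℝ] ℝ}
    (hc : ∀ k p, c k (X p) = c (k + 1) p) (k : ℕ) : (derivAlong X)^[k] ⇑(c 0) = c k := by
  induction k with
  | zero => rfl
  | succ k ih =>
    rw [Function.iterate_succ_apply', ih]
    exact funext fun p => (lineDeriv_clm (c k) p (X p)).trans (hc k p)

theorem iterate_derivAlong_seqShift {ι : Type} (k : ℕ) (i : ι) :
    (derivAlong (seqShift (ι → ℝ)))^[k] (fun Y => Y 0 i) = fun Y => Y k i :=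
  iterate_derivAlong_clm (X := seqShift (ι → ℝ)) (c := fun k =>
    .proj (R := ℝ) (φ := fun _ : ι => ℝ) i ∘L .proj (R := ℝ) (φ := fun _ : ℕ => ι → ℝ) k)
    (fun _ _ => rfl) k

end Coordinates

/-! ### Output jets and flatness -/

section OutputJet

variable {nx nu : ℕ} {ι : Type}

theorem iterate_derivAlong_cartanField (f : StateInput nx nu → Fin nx → ℝ) (k : ℕ) (j : Fin nu) :
    (derivAlong (cartanField f))^[k] (fun ξ => ξ.2 0 j) = fun ξ => ξ.2 k j :=
  iterate_derivAlong_clm (X := cartanField f) (c := fun k =>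
    .proj (R := ℝ) (φ := fun _ : Fin nu => ℝ) j ∘L
      .proj (R := ℝ) (φ := fun _ : ℕ => Fin nu → ℝ) k ∘L .snd ℝ _ _)
    (fun _ _ => rfl) k

/-- The sequence `(y, y', y'', …)` of all the time derivatives of `y = h(x,u)` at a jet. -/
def outputJet (f : StateInput nx nu → Fin nx → ℝ) (h : StateInput nx nu → ι → ℝ)
    (ξ : Jet nx nu) : ℕ → ι → ℝ :=
  fun k i => outputDeriv f h k i ξ

variable (nx nu) in
/-- `Jet.base` as a continuous linear map. -/
def baseCLM : Jet nx nu →L[ℝ] StateInput nx nu :=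
  (ContinuousLinearMap.fst ℝ _ _).prod (.proj (R := ℝ) (φ := fun _ : ℕ => Fin nu → ℝ) 0 ∘L
    .snd ℝ _ _)

theorem derivAlong_cartanField_base (f : StateInput nx nu → Fin nx → ℝ) (ξ : Jet nx nu) :
    derivAlong (cartanField f) Jet.base ξ = (f (Jet.base ξ), ξ.2 1) :=
  lineDeriv_clm (baseCLM nx nu) ξ _

theorem smoothNear_base (ξ : Jet nx nu) : SmoothNear Jet.base ξ :=
  .clm (baseCLM nx nu) ξ

variable {f : StateInput nx nu → Fin nx → ℝ} {h : StateInput nx nu → ι → ℝ} {ξ : Jet nx nu}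

theorem smoothFieldNear_cartanField (hf : ∀ᶠ p in 𝓝 (Jet.base ξ), ContDiffAt ℝ ∞ f p) :
    SmoothFieldNear (cartanField f) ξ := by
  intro E _ _ L
  have hsplit : L ∘ cartanField f =
      (fun e : (Fin nx → ℝ) × E => (L ∘L .inl ℝ _ _) e.1 + e.2) ∘
        fun ξ => (f (Jet.base ξ), (L ∘L .inr ℝ _ _ ∘L seqShift _ ∘L .snd ℝ _ _) ξ) := by
    funext ξ
    simp [cartanField, seqShift, ← map_add, Pi.compRightL]
  rw [hsplit]
  exact (((smoothNear_base ξ).comp hf).prodMk (.clm _ ξ)).comp_contDiff (by fun_prop)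

theorem smoothNear_outputDeriv [Fintype ι] (hf : ∀ᶠ p in 𝓝 (Jet.base ξ), ContDiffAt ℝ ∞ f p)
    (hh : ∀ᶠ p in 𝓝 (Jet.base ξ), ContDiffAt ℝ ∞ h p) (k : ℕ) (i : ι) :
    SmoothNear (outputDeriv f h k i) ξ :=
  (((smoothNear_base ξ).comp hh).apply i).iterate_derivAlong (smoothFieldNear_cartanField hf) k

theorem continuousAt_outputJet [Fintype ι] (hf : ∀ᶠ p in 𝓝 (Jet.base ξ), ContDiffAt ℝ ∞ f p)
    (hh : ∀ᶠ p in 𝓝 (Jet.base ξ), ContDiffAt ℝ ∞ h p) : ContinuousAt (outputJet f h) ξ :=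
  continuousAt_pi.2 fun k => continuousAt_pi.2 fun i =>
    (smoothNear_outputDeriv hf hh k i).continuousAt

theorem isRelatedAt_outputJet [Fintype ι] (hf : ∀ᶠ p in 𝓝 (Jet.base ξ), ContDiffAt ℝ ∞ f p)
    (hh : ∀ᶠ p in 𝓝 (Jet.base ξ), ContDiffAt ℝ ∞ h p) :
    IsRelatedAt (outputJet f h) (cartanField f) (seqShift _) ξ := by
  refine hasVelocityAt_pi.2 fun k => hasVelocityAt_pi.2 fun i => ?_
  have hderiv := (smoothNear_outputDeriv hf hh k i).hasLineDerivAt (cartanField f ξ)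
  have hsucc : outputDeriv f h (k + 1) i ξ =
      lineDeriv ℝ (outputDeriv f h k i) ξ (cartanField f ξ) :=
    congrFun (Function.iterate_succ_apply' (totalDeriv f) k _) ξ
  rw [← hsucc] at hderiv
  exact hasVelocityAt_iff_hasDerivAt.2 hderiv

end OutputJet

section Parametrization

variable {nx nu : ℕ} {ι : Type}

/-- The jet of the trajectory along which `(x, u)` is the function `s` of `y, y', y'', …`. -/
def jetLift (s : (ℕ → ι → ℝ) → StateInput nx nu) (Y : ℕ → ι → ℝ) : Jet nx nu :=
  ((s Y).1, fun k j => (derivAlong (seqShift _))^[k] (fun Y => (s Y).2 j) Y)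

/-- Near the sequence `Y₀`, the function `s` smoothly assigns a solution `(x, u)` of
`x' = f(x,u)`, `y = h(x,u)` to an arbitrary `y`; a `y` is encoded by the sequence
`(y, y', y'', …)` and the time derivative by the shift. -/
structure IsParametrizationAt (f : StateInput nx nu → Fin nx → ℝ) (h : StateInput nx nu → ι → ℝ)
    (s : (ℕ → ι → ℝ) → StateInput nx nu) (Y₀ : ℕ → ι → ℝ) : Prop where
  smooth : SmoothNear s Y₀
  output : ∀ᶠ Y in 𝓝 Y₀, h (s Y) = Y 0
  solves : ∀ᶠ Y in 𝓝 Y₀, (derivAlong (seqShift _) s Y).1 = f (s Y)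

variable {s : (ℕ → ι → ℝ) → StateInput nx nu} {Y : ℕ → ι → ℝ}

theorem smoothNear_jetLift_input (hs : SmoothNear s Y) (k : ℕ) (j : Fin nu) :
    SmoothNear (fun Y => (jetLift s Y).2 k j) Y :=
  (hs.comp_contDiff (H := fun p : StateInput nx nu => p.2 j) (by fun_prop)).iterate_derivAlong
    (smoothFieldNear_clm _ Y) k

theorem continuousAt_jetLift (hs : SmoothNear s Y) : ContinuousAt (jetLift s) Y :=
  (continuousAt_fst.comp hs.continuousAt).prodMk <| continuousAt_pi.2 fun k =>
    continuousAt_pi.2 fun j => (smoothNear_jetLift_input hs k j).continuousAt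

theorem hasVelocityAt_jetLift (hs : SmoothNear s Y) (V : ℕ → ι → ℝ) :
    HasVelocityAt (fun t : ℝ => jetLift s (Y + t • V))
      ((lineDeriv ℝ s Y V).1, fun k j => lineDeriv ℝ (fun Y => (jetLift s Y).2 k j) Y V) 0 := by
  refine HasVelocityAt.prodMk ?_ (hasVelocityAt_pi.2 fun k => hasVelocityAt_pi.2 fun j => ?_)
  · exact (hasVelocityAt_iff_hasDerivAt.2 (hs.hasLineDerivAt V)).clm_comp (.fst ℝ _ _)
  · exact hasVelocityAt_iff_hasDerivAt.2 ((smoothNear_jetLift_input hs k j).hasLineDerivAt V)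

variable {f : StateInput nx nu → Fin nx → ℝ} {h : StateInput nx nu → ι → ℝ}

theorem isRelatedAt_jetLift (hs : SmoothNear s Y)
    (hsolves : (derivAlong (seqShift _) s Y).1 = f (s Y)) :
    IsRelatedAt (jetLift s) (seqShift _) (cartanField f) Y := by
  have hvel := hasVelocityAt_jetLift hs (seqShift _ Y)
  have hcartan : cartanField f (jetLift s Y) = ((lineDeriv ℝ s Y (seqShift _ Y)).1,
      fun k j => lineDeriv ℝ (fun Y => (jetLift s Y).2 k j) Y (seqShift _ Y)) := by
    refine Prod.ext hsolves.symm (funext fun k => funext fun j => ?_)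
    exact congrFun (Function.iterate_succ_apply' (derivAlong (seqShift (ι → ℝ))) k _) Y
  rwa [← hcartan] at hvel

theorem IsParametrizationAt.eventually_isRelatedAt_jetLift (hs : IsParametrizationAt f h s Y) :
    ∀ᶠ Y' in 𝓝 Y, IsRelatedAt (jetLift s) (seqShift _) (cartanField f) Y' := by
  filter_upwards [hs.smooth.eventually, hs.solves] with Y' hsY' hsolves
  exact isRelatedAt_jetLift hsY' hsolves

theorem IsParametrizationAt.eventually (hs : IsParametrizationAt f h s Y) :
    ∀ᶠ Y' in 𝓝 Y, IsParametrizationAt f h s Y' := by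
  filter_upwards [hs.smooth.eventually, hs.output.eventually_nhds, hs.solves.eventually_nhds]
    with Y' hsmooth houtput hsolves
  exact ⟨hsmooth, houtput, hsolves⟩

variable [Fintype ι]

theorem outputDeriv_comp_jetLift (hs : IsParametrizationAt f h s Y)
    (hf : ∀ᶠ p in 𝓝 (s Y), ContDiffAt ℝ ∞ f p) (hh : ∀ᶠ p in 𝓝 (s Y), ContDiffAt ℝ ∞ h p)
    (k : ℕ) (i : ι) : outputDeriv f h k i ∘ jetLift s =ᶠ[𝓝 Y] fun Y' => Y' k i := by
  have hcomp : (derivAlong (seqShift _))^[k] ((fun ξ => h (Jet.base ξ) i) ∘ jetLift s) =ᶠ[𝓝 Y]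
      outputDeriv f h k i ∘ jetLift s :=
    iterate_derivAlong_comp_eventuallyEq hs.eventually_isRelatedAt_jetLift
      (continuousAt_jetLift hs.smooth) (smoothFieldNear_cartanField hf)
      (((smoothNear_base _).comp hh).apply i) k
  have houtput : (fun ξ => h (Jet.base ξ) i) ∘ jetLift s =ᶠ[𝓝 Y] fun Y' => Y' 0 i := by
    filter_upwards [hs.output] with Y' hY'
    exact congrFun hY' i
  exact (hcomp.symm.trans (iterate_derivAlong_congr houtput _ k)).trans
    (.of_eq (iterate_derivAlong_seqShift k i))

theorem jetLift_outputJet {ξ : Jet nx nu} (hs : SmoothNear s (outputJet f h ξ))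
    (hf : ∀ᶠ p in 𝓝 (Jet.base ξ), ContDiffAt ℝ ∞ f p)
    (hh : ∀ᶠ p in 𝓝 (Jet.base ξ), ContDiffAt ℝ ∞ h p)
    (hbase : s ∘ outputJet f h =ᶠ[𝓝 ξ] Jet.base) : jetLift s (outputJet f h ξ) = ξ := by
  have hstate : (s (outputJet f h ξ)).1 = ξ.1 := congrArg Prod.fst hbase.eq_of_nhds
  refine Prod.ext hstate (funext fun k => funext fun j => ?_)
  have hrelated : ∀ᶠ ξ' in 𝓝 ξ, IsRelatedAt (outputJet f h) (cartanField f) (seqShift _) ξ' := by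
    have hbaseξ : ContinuousAt Jet.base ξ := (smoothNear_base ξ).continuousAt
    filter_upwards [hbaseξ.eventually hf.eventually_nhds, hbaseξ.eventually hh.eventually_nhds]
      with ξ' hfξ' hhξ'
    exact isRelatedAt_outputJet hfξ' hhξ'
  have hcomp := iterate_derivAlong_comp_eventuallyEq hrelated (continuousAt_outputJet hf hh)
    (smoothFieldNear_clm _ _)
    (hs.comp_contDiff (H := fun p : StateInput nx nu => p.2 j) (by fun_prop)) k
  have hinput : (fun p => p.2 j) ∘ s ∘ outputJet f h =ᶠ[𝓝 ξ] fun ξ' => ξ'.2 0 j :=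
    hbase.fun_comp fun p => p.2 j
  calc (jetLift s (outputJet f h ξ)).2 k j
      = (derivAlong (cartanField f))^[k] ((fun p => p.2 j) ∘ s ∘ outputJet f h) ξ :=
        hcomp.eq_of_nhds.symm
    _ = (derivAlong (cartanField f))^[k] (fun ξ' => ξ'.2 0 j) ξ :=
        (iterate_derivAlong_congr hinput _ k).eq_of_nhds
    _ = ξ.2 k j := congrFun (iterate_derivAlong_cartanField f k j) ξ

theorem linearIndependent_of_forall_exists_apply_eq {κ α : Type*} {F : κ → α → ℝ}
    (hF : ∀ c : κ → ℝ, ∃ a, ∀ p, F p a = c p) : LinearIndependent ℝ F := by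
  classical
  choose w hw using fun q => hF (Pi.single q 1)
  refine LinearIndependent.of_comp (LinearMap.funLeft ℝ ℝ w) ?_
  convert Pi.linearIndependent_single_one κ ℝ with p
  ext q
  simp [LinearMap.funLeft_apply, hw, Pi.single_apply, eq_comm]

theorem differentiallyIndependentAt_jetLift (hs : IsParametrizationAt f h s Y)
    (hf : ∀ᶠ p in 𝓝 (s Y), ContDiffAt ℝ ∞ f p) (hh : ∀ᶠ p in 𝓝 (s Y), ContDiffAt ℝ ∞ h p) :
    DifferentiallyIndependentAt f h (jetLift s Y) := by
  refine linearIndependent_of_forall_exists_apply_eq fun c => ?_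
  let V : ℕ → ι → ℝ := Function.curry c
  obtain ⟨v, hv⟩ : ∃ v, HasVelocityAt (fun t : ℝ => jetLift s (Y + t • V)) v 0 :=
    ⟨_, hasVelocityAt_jetLift hs.smooth V⟩
  refine ⟨v, fun ⟨k, i⟩ => ?_⟩
  have hlift : HasDerivAt (fun t : ℝ => outputDeriv f h k i (jetLift s (Y + t • V))) _ 0 :=
    hv.comp_smoothNear (g := outputDeriv f h k i)
      (by rw [zero_smul, add_zero]; exact smoothNear_outputDeriv hf hh k i)
  have hcoord : HasDerivAt (fun t : ℝ => (Y + t • V) k i) (V k i) 0 := by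
    simpa using ((hasDerivAt_id (0 : ℝ)).mul_const (V k i)).const_add (Y k i)
  have hline : Tendsto (fun t : ℝ => Y + t • V) (𝓝 0) (𝓝 Y) := by
    simpa using (hasVelocityAt_line Y V).continuousAt.tendsto
  have heq := hlift.unique
    (hcoord.congr_of_eventuallyEq (hline.eventually (outputDeriv_comp_jetLift hs hf hh k i)))
  rwa [zero_smul, add_zero] at heq

theorem isFlatOutputAt_of_isParametrizationAt {ξ₀ : Jet nx nu} (hcard : Fintype.card ι = nu)
    (hf : ∀ᶠ p in 𝓝 (Jet.base ξ₀), ContDiffAt ℝ ∞ f p)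
    (hh : ∀ᶠ p in 𝓝 (Jet.base ξ₀), ContDiffAt ℝ ∞ h p)
    (hs : IsParametrizationAt f h s (outputJet f h ξ₀))
    (hbase : ∀ᶠ ξ in 𝓝 ξ₀, s (outputJet f h ξ) = Jet.base ξ) : IsFlatOutputAt f h ξ₀ := by
  obtain ⟨r, F, hF, hsF⟩ := hs.smooth.exists_eventuallyEq_comp_truncation
  obtain ⟨V, hFV, hV, hξ₀V⟩ := eventually_nhds_iff.1 hF
  obtain ⟨W, hhW, hW, hξ₀W⟩ := eventually_nhds_iff.1 hh
  have hbaseξ₀ : ContinuousAt Jet.base ξ₀ := (smoothNear_base ξ₀).continuousAt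
  have hjet : ContinuousAt (outputJet f h) ξ₀ := continuousAt_outputJet hf hh
  have hindep : ∀ᶠ ξ in 𝓝 ξ₀, DifferentiallyIndependentAt f h ξ := by
    filter_upwards [hjet.eventually hs.eventually, hbase.eventually_nhds,
      hbaseξ₀.eventually hf.eventually_nhds, hbaseξ₀.eventually hh.eventually_nhds]
      with ξ hsξ hbaseξ hfξ hhξ
    have hsbase : s (outputJet f h ξ) = Jet.base ξ := hbaseξ.self_of_nhds
    rw [← jetLift_outputJet hsξ.smooth hfξ hhξ hbaseξ]
    exact differentiallyIndependentAt_jetLift hsξ (by rwa [hsbase]) (by rwa [hsbase])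
  have hparam : ∀ᶠ ξ in 𝓝 ξ₀, truncation _ r (outputJet f h ξ) ∈ V ∧
      F (truncation _ r (outputJet f h ξ)) = Jet.base ξ := by
    filter_upwards [hbase, hjet.eventually hsF, ((truncation _ r).continuous.continuousAt.comp
      hjet).eventually (hV.mem_nhds hξ₀V)] with ξ hbaseξ hsFξ hξV
    exact ⟨hξV, hsFξ.symm.trans hbaseξ⟩
  obtain ⟨N, hN, hNo, hξ₀N⟩ := eventually_nhds_iff.1 (hindep.and hparam)
  exact
    { card_eq := hcard
      smooth := ⟨W, hW, hξ₀W, fun p hp => (hhW p hp).contDiffWithinAt⟩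
      flat := ⟨N, hNo, hξ₀N, fun ξ hξ => (hN ξ hξ).1, r, V, F, hV,
        fun y hy => (hFV y hy).contDiffWithinAt, fun ξ hξ => (hN ξ hξ).2⟩ }

end Parametrization

/-! ### Solving the triangular equations -/

section HatCoordinates

variable {B : BlockPartition} (i : Fin B.nb)

/-- The inclusion of the coordinates `ẑ` of the block `i.succ`, which are the unknowns of the
`i`-th block of equations, in the space of all the coordinates `z`. -/
def hatInclusion : (Fin (B.nh i.succ) → ℝ) →L[ℝ] B.Coord :=
  LinearMap.toContinuousLinearMap
    (Function.ExtendByZero.linearMap ℝ fun l => (⟨i.succ, Sum.inr l⟩ : B.Index))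

/-- The coordinates `ẑ` of the block `i.succ`. -/
def hatPart (z : B.Coord) : Fin (B.nh i.succ) → ℝ :=
  fun l => z ⟨i.succ, Sum.inr l⟩

theorem hatIndex_injective :
    Function.Injective fun l : Fin (B.nh i.succ) => (⟨i.succ, Sum.inr l⟩ : B.Index) :=
  sigma_mk_injective.comp Sum.inr_injective

theorem hatInclusion_apply_hat (w : Fin (B.nh i.succ) → ℝ) (l : Fin (B.nh i.succ)) :
    hatInclusion i w ⟨i.succ, Sum.inr l⟩ = w l :=
  (hatIndex_injective i).extend_apply w (0 : B.Coord) l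

variable {i} in
theorem hatInclusion_apply_eq_zero (w : Fin (B.nh i.succ) → ℝ) {κ : B.Index}
    (hκ : ∀ l, (⟨i.succ, Sum.inr l⟩ : B.Index) ≠ κ) : hatInclusion i w κ = 0 :=
  Function.extend_apply' w (0 : B.Coord) κ fun ⟨l, hl⟩ => hκ l hl

theorem hatInclusion_apply_inl (w : Fin (B.nh i.succ) → ℝ) (k : Fin (B.nb + 1)) (l : Fin (B.ny k)) :
    hatInclusion i w ⟨k, Sum.inl l⟩ = 0 :=
  hatInclusion_apply_eq_zero w fun l' h => by cases h

variable {i} in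
theorem hatInclusion_apply_of_le (w : Fin (B.nh i.succ) → ℝ) {κ : B.Index}
    (hκ : κ.1 ≤ i.castSucc) : hatInclusion i w κ = 0 := by
  refine hatInclusion_apply_eq_zero w ?_
  rintro l rfl
  exact absurd hκ (not_le.2 i.castSucc_lt_succ)

theorem hatInclusion_single (l : Fin (B.nh i.succ)) :
    hatInclusion i (Pi.single l 1) = Pi.single ⟨i.succ, Sum.inr l⟩ 1 := by
  funext κ
  by_cases hκ : ∃ l', (⟨i.succ, Sum.inr l'⟩ : B.Index) = κ
  · obtain ⟨l', rfl⟩ := hκ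
    simp [hatInclusion_apply_hat, Pi.single_apply]
  · push Not at hκ
    rw [hatInclusion_apply_eq_zero _ hκ, Pi.single_eq_of_ne (hκ l).symm]

variable {i} in
theorem add_hatInclusion_hatPart_sub {z z' : B.Coord} (hy : B.yPart z = B.yPart z')
    (hz : ∀ κ : B.Index, κ.1 ≤ i.castSucc → z κ = z' κ) {κ : B.Index} (hκ : κ.1 ≤ i.succ) :
    (z + hatInclusion i (hatPart i (z' - z))) κ = z' κ := by
  rw [Pi.add_apply]
  obtain ⟨k, l | l⟩ := κ
  · rw [hatInclusion_apply_inl, add_zero]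
    exact congrFun hy ⟨k, l⟩
  · rcases eq_or_lt_of_le hκ with rfl | hlt
    · rw [hatInclusion_apply_hat]
      exact add_sub_cancel _ _
    · have hle : k ≤ i.castSucc := Fin.le_castSucc_iff.2 hlt
      rw [hatInclusion_apply_of_le _ hle, add_zero]
      exact hz _ hle

variable {i} in
theorem le_succ_of_allowed {κ : B.Index} (hκ : B.Allowed i κ) : κ.1 ≤ i.succ := by
  obtain ⟨k, l | l⟩ := κ
  · exact le_trans hκ i.castSucc_lt_succ.le
  · exact hκ

end HatCoordinates

section BlockEquations

variable {B : BlockPartition} {Z : Set B.Coord} (T : TriangularEquations B Z) {i : Fin B.nb}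
  {z z' v v' : B.Coord}

theorem TriangularEquations.lhs_congr_velocity (hv : ∀ κ : B.Index, κ.1 ≤ i.castSucc → v κ = v' κ)
    (j : Fin (B.nh i.succ)) (z : B.Coord) : T.lhs i j z v = T.lhs i j z v' := by
  unfold TriangularEquations.lhs
  congr 1
  refine Finset.sum_congr rfl fun κ _ => ?_
  split_ifs with hκ
  · rw [hv κ hκ]
  · rfl

theorem TriangularEquations.lhs_congr (hz : z ∈ Z) (hz' : z' ∈ Z)
    (hzz' : ∀ κ : B.Index, κ.1 ≤ i.succ → z κ = z' κ)
    (hv : ∀ κ : B.Index, κ.1 ≤ i.castSucc → v κ = v' κ) (j : Fin (B.nh i.succ)) :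
    T.lhs i j z v = T.lhs i j z' v' := by
  have hallowed : ∀ κ, B.Allowed i κ → z κ = z' κ := fun κ hκ => hzz' κ (le_succ_of_allowed hκ)
  rw [T.lhs_congr_velocity hv]
  simp only [TriangularEquations.lhs, T.a_dep i j _ z hz z' hz' hallowed,
    T.b_dep i j z hz z' hz' hallowed]

theorem TriangularEquations.jacobian_congr_velocity
    (hv : ∀ κ : B.Index, κ.1 ≤ i.castSucc → v κ = v' κ) (z : B.Coord) :
    T.jacobian i z v = T.jacobian i z v' := by
  simp only [TriangularEquations.jacobian, T.lhs_congr_velocity hv]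

theorem TriangularEquations.contDiffAt_lhs (hZ : Z ∈ 𝓝 z) (i : Fin B.nb) (j : Fin (B.nh i.succ))
    (v : B.Coord) : ContDiffAt ℝ ∞ (fun q : B.Coord × B.Coord => T.lhs i j q.1 q.2) (z, v) := by
  refine ContDiffAt.sub (ContDiffAt.sum fun κ _ => ?_) ?_
  · split_ifs
    · exact (((T.a_smooth i j κ).contDiffAt hZ).comp (z, v) contDiffAt_fst).mul (by fun_prop)
    · exact contDiffAt_const
  · exact ((T.b_smooth i j).contDiffAt hZ).comp (z, v) contDiffAt_fst

/-- The `i`-th block of equations as a function of `((z, ż), w)`, where the unknown `w` is added to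
the coordinates `ẑ` of the block `i.succ`. -/
def TriangularEquations.blockMap (i : Fin B.nb)
    (q : (B.Coord × B.Coord) × (Fin (B.nh i.succ) → ℝ)) : Fin (B.nh i.succ) → ℝ :=
  fun j => T.lhs i j (q.1.1 + hatInclusion i q.2) q.1.2

theorem TriangularEquations.contDiffAt_blockMap
    {q : (B.Coord × B.Coord) × (Fin (B.nh i.succ) → ℝ)}
    (hZ : Z ∈ 𝓝 (q.1.1 + hatInclusion i q.2)) : ContDiffAt ℝ ∞ (T.blockMap i) q := by
  refine contDiffAt_pi.2 fun j => ?_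
  have haffine : ContDiff ℝ ∞ fun q : (B.Coord × B.Coord) × (Fin (B.nh i.succ) → ℝ) =>
      (q.1.1 + hatInclusion i q.2, q.1.2) := by fun_prop
  exact (T.contDiffAt_lhs hZ i j q.1.2).comp q haffine.contDiffAt

theorem TriangularEquations.toMatrix'_fderiv_blockMap (hZ : Z ∈ 𝓝 z) (i : Fin B.nb)
    (v : B.Coord) :
    LinearMap.toMatrix' (fderiv ℝ (T.blockMap i) ((z, v), 0) ∘L .inr ℝ _ _ :
      (Fin (B.nh i.succ) → ℝ) →L[ℝ] _).toLinearMap = T.jacobian i z v := by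
  have hdiff : DifferentiableAt ℝ (T.blockMap i) ((z, v), 0) :=
    (T.contDiffAt_blockMap (by simpa using hZ)).differentiableAt (by simp)
  have htotal : HasFDerivAt (fun w => T.blockMap i ((z, v), w))
      (fderiv ℝ (T.blockMap i) ((z, v), 0) ∘L .inr ℝ _ _) 0 :=
    hdiff.hasFDerivAt.comp (0 : Fin (B.nh i.succ) → ℝ) (hasFDerivAt_prodMk_right (z, v) 0)
  have hpartial : HasFDerivAt (fun w => T.blockMap i ((z, v), w))
      (ContinuousLinearMap.pi fun j =>
        fderiv ℝ (fun z => T.lhs i j z v) z ∘L hatInclusion i) 0 := by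
    refine hasFDerivAt_pi.2 fun j => ?_
    have hlhs : ContDiffAt ℝ ∞ (fun z => T.lhs i j z v) z :=
      (T.contDiffAt_lhs hZ i j v).comp z (contDiffAt_id.prodMk contDiffAt_const)
    have hlhs' : HasFDerivAt (fun z => T.lhs i j z v) (fderiv ℝ (fun z => T.lhs i j z v) z)
        (z + hatInclusion i 0) := by
      simpa using (hlhs.differentiableAt (by simp)).hasFDerivAt
    exact hlhs'.comp (0 : Fin (B.nh i.succ) → ℝ) ((hatInclusion i).hasFDerivAt.const_add z)
  ext j l
  rw [htotal.unique hpartial]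
  simp [LinearMap.toMatrix'_apply, TriangularEquations.jacobian, hatInclusion_single]

theorem TriangularEquations.isInvertible_fderiv_blockMap (hZ : Z ∈ 𝓝 z)
    (hdet : (T.jacobian i z v).det ≠ 0) :
    (fderiv ℝ (T.blockMap i) ((z, v), 0) ∘L .inr ℝ _ (Fin (B.nh i.succ) → ℝ)).IsInvertible := by
  rw [← T.toMatrix'_fderiv_blockMap hZ, LinearMap.det_toMatrix'] at hdet
  exact ⟨ContinuousLinearMap.toContinuousLinearEquivOfDetNeZero _ hdet, rfl⟩

/-- Near `(z, v)`, the increment `ψ` of the coordinates `ẑ` of the block `i.succ` is the unique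
solution of the `i`-th block of equations. -/
structure TriangularEquations.IsHatSolutionAt (i : Fin B.nb)
    (ψ : B.Coord × B.Coord → Fin (B.nh i.succ) → ℝ) (z v : B.Coord) : Prop where
  smooth : ∀ᶠ p in 𝓝 (z, v), ContDiffAt ℝ ∞ ψ p
  apply_self : ψ (z, v) = 0
  iff_eq : ∀ᶠ q : _ × _ in 𝓝 ((z, v), 0),
    (∀ j, T.lhs i j (q.1.1 + hatInclusion i q.2) q.1.2 = 0) ↔ ψ q.1 = q.2

theorem TriangularEquations.exists_isHatSolutionAt (hZo : IsOpen Z) (hz : z ∈ Z)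
    (hdet : (T.jacobian i z v).det ≠ 0) (hzero : ∀ j, T.lhs i j z v = 0) :
    ∃ ψ, T.IsHatSolutionAt i ψ z v := by
  have hsmooth : ∀ᶠ q in 𝓝 ((z, v), 0), ContDiffAt ℝ ∞ (T.blockMap i) q := by
    have hcont : Continuous fun q : (B.Coord × B.Coord) × (Fin (B.nh i.succ) → ℝ) =>
        q.1.1 + hatInclusion i q.2 := by fun_prop
    filter_upwards [(hZo.preimage hcont).mem_nhds (x := ((z, v), 0)) (by simpa using hz)] with q hq
    exact T.contDiffAt_blockMap (hZo.mem_nhds hq)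
  have hinv := T.isInvertible_fderiv_blockMap (hZo.mem_nhds hz) hdet
  have hblock : T.blockMap i ((z, v), 0) = 0 := by
    funext j
    simpa [TriangularEquations.blockMap] using hzero j
  refine ⟨hsmooth.self_of_nhds.implicitFunction (by simp) hinv,
    eventually_contDiffAt_implicitFunction (by simp) hsmooth hinv,
    hsmooth.self_of_nhds.implicitFunction_apply_self (by simp) hinv, ?_⟩
  filter_upwards [hsmooth.self_of_nhds.eventually_apply_eq_iff_implicitFunction (by simp) hinv]
    with q hq
  rw [← hq, hblock, funext_iff]
  rfl

theorem TriangularEquations.IsHatSolutionAt.eventually_lhs_eq_zero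
    {ψ : B.Coord × B.Coord → Fin (B.nh i.succ) → ℝ} (hψ : T.IsHatSolutionAt i ψ z v) :
    ∀ᶠ p in 𝓝 (z, v), ∀ j, T.lhs i j (p.1 + hatInclusion i (ψ p)) p.2 = 0 := by
  have hgraph : Tendsto (fun p => (p, ψ p)) (𝓝 (z, v)) (𝓝 ((z, v), 0)) := by
    simpa [hψ.apply_self] using
      (continuousAt_id.prodMk hψ.smooth.self_of_nhds.continuousAt).tendsto
  filter_upwards [hgraph.eventually hψ.iff_eq] with p hp
  exact hp.2 rfl

end BlockEquations

section BlockParametrization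

theorem eventually_contDiffAt_of_contDiffOn {𝕜 E F : Type*} [NontriviallyNormedField 𝕜]
    [NormedAddCommGroup E] [NormedSpace 𝕜 E] [NormedAddCommGroup F] [NormedSpace 𝕜 F]
    {n : WithTop ℕ∞} {f : E → F} {s : Set E} {x : E} (hf : ContDiffOn 𝕜 n f s) (hs : IsOpen s)
    (hx : x ∈ s) : ∀ᶠ y in 𝓝 x, ContDiffAt 𝕜 n f y := by
  filter_upwards [hs.mem_nhds hx] with y hy
  exact hf.contDiffAt (hs.mem_nhds hy)

variable {nx nu : ℕ} {B : BlockPartition} {φ : OpenPartialHomeomorph B.Coord (StateInput nx nu)}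
  {f : StateInput nx nu → Fin nx → ℝ}

theorem Represents.forall_lhs_derivAlong_eq_zero_iff {J : Type} [AddCommGroup J] [Module ℝ J]
    [TopologicalSpace J] [ContinuousAdd J] [ContinuousSMul ℝ J] {Z : Set B.Coord}
    {T : TriangularEquations B Z} {φ : B.Coord → StateInput nx nu} (hT : Represents T φ f)
    {X : J → J} {g : J → B.Coord} {p : J} (hg : SmoothNear g p) (hgp : g p ∈ Z)
    (hφ : DifferentiableAt ℝ φ (g p)) :
    (∀ i j, T.lhs i j (g p) (derivAlong X g p) = 0) ↔
      (derivAlong X (φ ∘ g) p).1 = f (φ (g p)) := by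
  rw [hg.derivAlong_comp hφ]
  exact hT (g p) hgp _

/-- The output `y` read as a function of `(x, u)` through `φ`. -/
def yOutput (φ : OpenPartialHomeomorph B.Coord (StateInput nx nu)) (p : StateInput nx nu) :
    B.YIndex → ℝ :=
  B.yPart (φ.symm p)

theorem eventually_contDiffAt_yOutput (hφsymm : ContDiffOn ℝ ∞ φ.symm φ.target)
    {p : StateInput nx nu} (hp : p ∈ φ.target) :
    ∀ᶠ q in 𝓝 p, ContDiffAt ℝ ∞ (yOutput φ) q := by
  filter_upwards [eventually_contDiffAt_of_contDiffOn hφsymm φ.open_target hp] with q hsymm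
  exact contDiffAt_pi.2 fun y => contDiffAt_pi.1 hsymm ⟨y.1, Sum.inl y.2⟩

theorem smoothNear_symm_base (hφsymm : ContDiffOn ℝ ∞ φ.symm φ.target) {ξ : Jet nx nu}
    (hξ : Jet.base ξ ∈ φ.target) : SmoothNear (φ.symm ∘ Jet.base) ξ :=
  (smoothNear_base ξ).comp (eventually_contDiffAt_of_contDiffOn hφsymm φ.open_target hξ)

theorem eventually_base_mem_target {ξ : Jet nx nu} (hξ : Jet.base ξ ∈ φ.target) :
    ∀ᶠ ξ' in 𝓝 ξ, Jet.base ξ' ∈ φ.target :=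
  (smoothNear_base ξ).continuousAt.eventually (φ.open_target.mem_nhds hξ)

theorem continuousAt_outputJet_yOutput (hf : ContDiffOn ℝ ∞ f φ.target)
    (hφsymm : ContDiffOn ℝ ∞ φ.symm φ.target) {ξ : Jet nx nu} (hξ : Jet.base ξ ∈ φ.target) :
    ContinuousAt (outputJet f (yOutput φ)) ξ :=
  continuousAt_outputJet (eventually_contDiffAt_of_contDiffOn hf φ.open_target hξ)
    (eventually_contDiffAt_yOutput hφsymm hξ)

theorem derivAlong_cartanField_symm_base (hφsymm : ContDiffOn ℝ ∞ φ.symm φ.target) {ξ : Jet nx nu}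
    (hξ : Jet.base ξ ∈ φ.target) : derivAlong (cartanField f) (φ.symm ∘ Jet.base) ξ =
      fderiv ℝ φ.symm (Jet.base ξ) (f (Jet.base ξ), ξ.2 1) := by
  have hsymm : ContDiffAt ℝ ∞ φ.symm (Jet.base ξ) :=
    hφsymm.contDiffAt (φ.open_target.mem_nhds hξ)
  rw [(smoothNear_base ξ).derivAlong_comp (hsymm.differentiableAt (by simp)),
    derivAlong_cartanField_base]

theorem Represents.lhs_symm_base {T : TriangularEquations B φ.source} (hT : Represents T φ f)
    (hφ : ContDiffOn ℝ ∞ φ φ.source) (hφsymm : ContDiffOn ℝ ∞ φ.symm φ.target) {ξ : Jet nx nu}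
    (hξ : Jet.base ξ ∈ φ.target) (i : Fin B.nb) (j : Fin (B.nh i.succ)) :
    T.lhs i j (φ.symm (Jet.base ξ)) (derivAlong (cartanField f) (φ.symm ∘ Jet.base) ξ) = 0 := by
  have hsource : φ.symm (Jet.base ξ) ∈ φ.source := φ.map_target hξ
  have hφξ : ContDiffAt ℝ ∞ φ (φ.symm (Jet.base ξ)) :=
    hφ.contDiffAt (φ.open_source.mem_nhds hsource)
  refine (hT.forall_lhs_derivAlong_eq_zero_iff (smoothNear_symm_base hφsymm hξ) hsource
    (hφξ.differentiableAt (by simp))).2 ?_ i j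
  have hinv : φ ∘ φ.symm ∘ Jet.base =ᶠ[𝓝 ξ] Jet.base := by
    filter_upwards [eventually_base_mem_target hξ] with ξ' hξ'
    exact φ.right_inv hξ'
  rw [(derivAlong_congr hinv _).eq_of_nhds, derivAlong_cartanField_base]
  exact congrArg f (φ.right_inv hξ).symm

/-- Near the output jet of `ξ₀`, the function `g` expresses the coordinates of the blocks up to `n`
through the time derivatives of `y`, and solves the equations in which no other blocks occur for an
arbitrary `y`. The coordinates `ẑ` of the other blocks may be anything that is correct at `ξ₀`. -/
structure IsBlockParametrization (f : StateInput nx nu → Fin nx → ℝ)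
    (φ : OpenPartialHomeomorph B.Coord (StateInput nx nu)) (T : TriangularEquations B φ.source)
    (ξ₀ : Jet nx nu) (n : Fin (B.nb + 1)) (g : (ℕ → B.YIndex → ℝ) → B.Coord) : Prop where
  smooth : SmoothNear g (outputJet f (yOutput φ) ξ₀)
  yPart_eq : ∀ Y, B.yPart (g Y) = Y 0
  base_eq : g (outputJet f (yOutput φ) ξ₀) = φ.symm (Jet.base ξ₀)
  agrees : ∀ᶠ ξ in 𝓝 ξ₀, ∀ κ : B.Index, κ.1 ≤ n →
    g (outputJet f (yOutput φ) ξ) κ = φ.symm (Jet.base ξ) κ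
  solves : ∀ᶠ Y in 𝓝 (outputJet f (yOutput φ) ξ₀), ∀ i : Fin B.nb, i.succ ≤ n → ∀ j,
    T.lhs i j (g Y) (derivAlong (seqShift _) g Y) = 0

variable {T : TriangularEquations B φ.source} {ξ₀ : Jet nx nu}

theorem exists_isBlockParametrization_zero (f : StateInput nx nu → Fin nx → ℝ)
    (T : TriangularEquations B φ.source) (ξ₀ : Jet nx nu) :
    ∃ g, IsBlockParametrization f φ T ξ₀ 0 g := by
  let G (y : B.YIndex → ℝ) (κ : B.Index) : ℝ :=
    κ.2.elim (fun l => y ⟨κ.1, l⟩) fun l => φ.symm (Jet.base ξ₀) ⟨κ.1, Sum.inr l⟩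
  have hG : ContDiff ℝ ∞ G := by
    refine contDiff_pi.2 ?_
    rintro ⟨i, l | l⟩
    · exact contDiff_apply ℝ ℝ (⟨i, l⟩ : B.YIndex)
    · exact contDiff_const
  refine ⟨fun Y => G (Y 0), ?_, fun Y => rfl, ?_, .of_forall fun ξ => ?_,
    .of_forall fun Y i hi => ?_⟩
  · exact (SmoothNear.clm (.proj (R := ℝ) (φ := fun _ : ℕ => B.YIndex → ℝ) 0) _).comp_contDiff hG
  · ext ⟨i, l | l⟩ <;> rfl
  · rintro ⟨i, l | l⟩ hi
    · rfl
    · obtain rfl : i = 0 := Fin.le_zero_iff.1 hi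
      exact absurd l.2 (by simp [B.nh_first])
  · exact absurd hi (not_le.2 i.succ_pos)

variable {n : Fin (B.nb + 1)} {i : Fin B.nb} {g : (ℕ → B.YIndex → ℝ) → B.Coord}
  {ψ : B.Coord × B.Coord → Fin (B.nh i.succ) → ℝ}

namespace IsBlockParametrization

theorem eventually_mem_source (hg : IsBlockParametrization f φ T ξ₀ n g)
    (hξ₀ : Jet.base ξ₀ ∈ φ.target) :
    ∀ᶠ Y in 𝓝 (outputJet f (yOutput φ) ξ₀), g Y ∈ φ.source :=
  hg.smooth.continuousAt.eventually
    (φ.open_source.mem_nhds (by rw [hg.base_eq]; exact φ.map_target hξ₀))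

theorem velocity_agrees (hg : IsBlockParametrization f φ T ξ₀ n g)
    (hf : ContDiffOn ℝ ∞ f φ.target) (hφsymm : ContDiffOn ℝ ∞ φ.symm φ.target)
    (hξ₀ : Jet.base ξ₀ ∈ φ.target) :
    ∀ᶠ ξ in 𝓝 ξ₀, ∀ κ : B.Index, κ.1 ≤ n →
      derivAlong (seqShift _) g (outputJet f (yOutput φ) ξ) κ =
        derivAlong (cartanField f) (φ.symm ∘ Jet.base) ξ κ := by
  filter_upwards [hg.agrees.eventually_nhds, eventually_base_mem_target hξ₀,
    (continuousAt_outputJet_yOutput hf hφsymm hξ₀).eventually hg.smooth.eventually]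
    with ξ hagrees hξ hsmooth κ hκ
  have hrelated : IsRelatedAt (outputJet f (yOutput φ)) (cartanField f) (seqShift _) ξ :=
    isRelatedAt_outputJet (eventually_contDiffAt_of_contDiffOn hf φ.open_target hξ)
      (eventually_contDiffAt_yOutput hφsymm hξ)
  have hagreesκ : (fun Y => g Y κ) ∘ outputJet f (yOutput φ) =ᶠ[𝓝 ξ]
      fun ξ => φ.symm (Jet.base ξ) κ :=
    hagrees.mono fun ξ' hξ' => hξ' κ hκ
  rw [hsmooth.derivAlong_apply, (smoothNear_symm_base hφsymm hξ).derivAlong_apply,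
    ← hrelated.derivAlong_comp (hsmooth.apply κ), (derivAlong_congr hagreesκ _).eq_of_nhds]
  rfl

theorem exists_isHatSolutionAt (hg : IsBlockParametrization f φ T ξ₀ i.castSucc g)
    (hf : ContDiffOn ℝ ∞ f φ.target) (hφ : ContDiffOn ℝ ∞ φ φ.source)
    (hφsymm : ContDiffOn ℝ ∞ φ.symm φ.target) (hT : Represents T φ f)
    (hξ₀ : Jet.base ξ₀ ∈ φ.target)
    (hdet : (T.jacobian i (φ.symm (Jet.base ξ₀)) (fderiv ℝ φ.symm (Jet.base ξ₀)
      (f (Jet.base ξ₀), ξ₀.2 1))).det ≠ 0) :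
    ∃ ψ, T.IsHatSolutionAt i ψ (g (outputJet f (yOutput φ) ξ₀))
      (derivAlong (seqShift _) g (outputJet f (yOutput φ) ξ₀)) := by
  have hvelocity := (hg.velocity_agrees hf hφsymm hξ₀).self_of_nhds
  rw [hg.base_eq]
  refine T.exists_isHatSolutionAt φ.open_source (φ.map_target hξ₀) ?_ fun j => ?_
  · rwa [T.jacobian_congr_velocity hvelocity, derivAlong_cartanField_symm_base hφsymm hξ₀]
  · rw [T.lhs_congr_velocity hvelocity]
    exact hT.lhs_symm_base hφ hφsymm hξ₀ i j

end IsBlockParametrization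

/-- The functions `g` corrected in the coordinates `ẑ` of the block `i.succ` by the solution `ψ` of
the `i`-th block of equations. -/
def solveBlock (ψ : B.Coord × B.Coord → Fin (B.nh i.succ) → ℝ) (g : (ℕ → B.YIndex → ℝ) → B.Coord)
    (Y : ℕ → B.YIndex → ℝ) : B.Coord :=
  g Y + hatInclusion i (ψ (g Y, derivAlong (seqShift _) g Y))

theorem solveBlock_apply_of_le (ψ : B.Coord × B.Coord → Fin (B.nh i.succ) → ℝ)
    (g : (ℕ → B.YIndex → ℝ) → B.Coord) (Y : ℕ → B.YIndex → ℝ) {κ : B.Index}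
    (hκ : κ.1 ≤ i.castSucc) : solveBlock ψ g Y κ = g Y κ := by
  rw [solveBlock, Pi.add_apply, hatInclusion_apply_of_le _ hκ, add_zero]

theorem derivAlong_solveBlock_apply_of_le {Y : ℕ → B.YIndex → ℝ} (hg : SmoothNear g Y)
    (hg' : SmoothNear (solveBlock ψ g) Y) {κ : B.Index} (hκ : κ.1 ≤ i.castSucc) :
    derivAlong (seqShift _) (solveBlock ψ g) Y κ = derivAlong (seqShift _) g Y κ := by
  rw [hg'.derivAlong_apply, hg.derivAlong_apply]
  simp only [solveBlock_apply_of_le ψ g _ hκ]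

theorem smoothNear_prodMk_derivAlong {Y : ℕ → B.YIndex → ℝ} (hg : SmoothNear g Y) :
    SmoothNear (fun Y => (g Y, derivAlong (seqShift _) g Y)) Y :=
  hg.prodMk (hg.derivAlong (smoothFieldNear_clm _ _))

theorem smoothNear_solveBlock {Y : ℕ → B.YIndex → ℝ} (hg : SmoothNear g Y)
    (hψ : ∀ᶠ p in 𝓝 (g Y, derivAlong (seqShift _) g Y), ContDiffAt ℝ ∞ ψ p) :
    SmoothNear (solveBlock ψ g) Y :=
  (hg.prodMk ((smoothNear_prodMk_derivAlong hg).comp hψ)).comp_contDiff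
    (H := fun q : B.Coord × (Fin (B.nh i.succ) → ℝ) => q.1 + hatInclusion i q.2) (by fun_prop)

namespace IsBlockParametrization

theorem eventually_solveBlock_agrees (hg : IsBlockParametrization f φ T ξ₀ i.castSucc g)
    (hf : ContDiffOn ℝ ∞ f φ.target) (hφ : ContDiffOn ℝ ∞ φ φ.source)
    (hφsymm : ContDiffOn ℝ ∞ φ.symm φ.target) (hT : Represents T φ f)
    (hξ₀ : Jet.base ξ₀ ∈ φ.target)
    (hψ : T.IsHatSolutionAt i ψ (g (outputJet f (yOutput φ) ξ₀))
      (derivAlong (seqShift _) g (outputJet f (yOutput φ) ξ₀))) :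
    ∀ᶠ ξ in 𝓝 ξ₀, ∀ κ : B.Index, κ.1 ≤ i.succ →
      solveBlock ψ g (outputJet f (yOutput φ) ξ) κ = φ.symm (Jet.base ξ) κ := by
  have hjet := continuousAt_outputJet_yOutput hf hφsymm hξ₀
  let increment (ξ : Jet nx nu) : Fin (B.nh i.succ) → ℝ :=
    hatPart i (φ.symm (Jet.base ξ) - g (outputJet f (yOutput φ) ξ))
  have hincrement : ContinuousAt increment ξ₀ :=
    continuousAt_pi.2 fun l => continuousAt_pi.1 ((smoothNear_symm_base hφsymm hξ₀).continuousAt.sub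
      (hg.smooth.continuousAt.comp hjet)) _
  have hincrement₀ : increment ξ₀ = 0 := by
    simp only [increment, hg.base_eq, sub_self]
    rfl
  have hcorrect : ContinuousAt
      (fun ξ => g (outputJet f (yOutput φ) ξ) + hatInclusion i (increment ξ)) ξ₀ :=
    (hg.smooth.continuousAt.comp hjet).add
      ((hatInclusion i).continuous.continuousAt.comp hincrement)
  have hsource : ∀ᶠ ξ in 𝓝 ξ₀,
      g (outputJet f (yOutput φ) ξ) + hatInclusion i (increment ξ) ∈ φ.source :=
    hcorrect.eventually (φ.open_source.mem_nhds
      (by simpa only [hincrement₀, map_zero, add_zero, hg.base_eq] using φ.map_target hξ₀))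
  have hunique :=
    ((smoothNear_prodMk_derivAlong hg.smooth).continuousAt.comp hjet).prodMk hincrement
  rw [ContinuousAt, hincrement₀] at hunique
  filter_upwards [hg.agrees, hg.velocity_agrees hf hφsymm hξ₀, eventually_base_mem_target hξ₀,
    hsource, hunique.eventually hψ.iff_eq] with ξ hagrees hvelocity hξ hξsource hξunique κ hκ
  have hz : ∀ κ : B.Index, κ.1 ≤ i.succ →
      (g (outputJet f (yOutput φ) ξ) + hatInclusion i (increment ξ)) κ = φ.symm (Jet.base ξ) κ :=
    fun κ hκ => add_hatInclusion_hatPart_sub (hg.yPart_eq _) hagrees hκ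
  have hψξ : ψ (g (outputJet f (yOutput φ) ξ),
      derivAlong (seqShift _) g (outputJet f (yOutput φ) ξ)) = increment ξ := by
    refine hξunique.1 fun j => ?_
    refine (T.lhs_congr hξsource (φ.map_target hξ) hz hvelocity j).trans ?_
    exact hT.lhs_symm_base hφ hφsymm hξ i j
  rw [solveBlock, hψξ]
  exact hz κ hκ

theorem eventually_lhs_solveBlock_eq_zero (hg : IsBlockParametrization f φ T ξ₀ i.castSucc g)
    (hξ₀ : Jet.base ξ₀ ∈ φ.target)
    (hψ : T.IsHatSolutionAt i ψ (g (outputJet f (yOutput φ) ξ₀))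
      (derivAlong (seqShift _) g (outputJet f (yOutput φ) ξ₀))) :
    ∀ᶠ Y in 𝓝 (outputJet f (yOutput φ) ξ₀), ∀ k : Fin B.nb, k.succ ≤ i.succ → ∀ j,
      T.lhs k j (solveBlock ψ g Y) (derivAlong (seqShift _) (solveBlock ψ g) Y) = 0 := by
  have hsmooth : SmoothNear (solveBlock ψ g) (outputJet f (yOutput φ) ξ₀) :=
    smoothNear_solveBlock hg.smooth hψ.smooth
  have hsource : solveBlock ψ g (outputJet f (yOutput φ) ξ₀) ∈ φ.source := by
    rw [solveBlock, hψ.apply_self, map_zero, add_zero, hg.base_eq]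
    exact φ.map_target hξ₀
  filter_upwards [hg.smooth.eventually, hsmooth.eventually, hg.eventually_mem_source hξ₀,
    hsmooth.continuousAt.eventually (φ.open_source.mem_nhds hsource), hg.solves,
    (smoothNear_prodMk_derivAlong hg.smooth).continuousAt.eventually hψ.eventually_lhs_eq_zero]
    with Y hgY hsolveY hgZ hsolveZ hsolves hnew k hk j
  have hvelocity : ∀ κ : B.Index, κ.1 ≤ i.castSucc →
      derivAlong (seqShift _) (solveBlock ψ g) Y κ = derivAlong (seqShift _) g Y κ :=
    fun κ hκ => derivAlong_solveBlock_apply_of_le hgY hsolveY hκ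
  rcases eq_or_lt_of_le (Fin.succ_le_succ_iff.1 hk) with rfl | hlt
  · rw [T.lhs_congr_velocity hvelocity]
    exact hnew j
  · have hle : k.succ ≤ i.castSucc := Fin.succ_le_castSucc_iff.2 hlt
    rw [T.lhs_congr hsolveZ hgZ (fun κ hκ => solveBlock_apply_of_le ψ g Y (hκ.trans hle))
      fun κ hκ => hvelocity κ (hκ.trans (k.castSucc_lt_succ.le.trans hle))]
    exact hsolves k hle j

theorem solveBlock (hg : IsBlockParametrization f φ T ξ₀ i.castSucc g)
    (hf : ContDiffOn ℝ ∞ f φ.target) (hφ : ContDiffOn ℝ ∞ φ φ.source)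
    (hφsymm : ContDiffOn ℝ ∞ φ.symm φ.target) (hT : Represents T φ f)
    (hξ₀ : Jet.base ξ₀ ∈ φ.target)
    (hψ : T.IsHatSolutionAt i ψ (g (outputJet f (yOutput φ) ξ₀))
      (derivAlong (seqShift _) g (outputJet f (yOutput φ) ξ₀))) :
    IsBlockParametrization f φ T ξ₀ i.succ (solveBlock ψ g) where
  smooth := smoothNear_solveBlock hg.smooth hψ.smooth
  yPart_eq Y := by
    rw [← hg.yPart_eq Y]
    funext y
    simp [BlockPartition.yPart, ControlFlat.solveBlock, hatInclusion_apply_inl]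
  base_eq := by
    rw [ControlFlat.solveBlock, hψ.apply_self, map_zero, add_zero, hg.base_eq]
  agrees := hg.eventually_solveBlock_agrees hf hφ hφsymm hT hξ₀ hψ
  solves := hg.eventually_lhs_solveBlock_eq_zero hξ₀ hψ

theorem isParametrizationAt {g : (ℕ → B.YIndex → ℝ) → B.Coord}
    (hg : IsBlockParametrization f φ T ξ₀ (Fin.last B.nb) g)
    (hφ : ContDiffOn ℝ ∞ φ φ.source) (hT : Represents T φ f) (hξ₀ : Jet.base ξ₀ ∈ φ.target) :
    IsParametrizationAt f (yOutput φ) (φ ∘ g) (outputJet f (yOutput φ) ξ₀) where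
  smooth := hg.smooth.comp
    (eventually_contDiffAt_of_contDiffOn hφ φ.open_source
      (hg.eventually_mem_source hξ₀).self_of_nhds)
  output := by
    filter_upwards [hg.eventually_mem_source hξ₀] with Y hY
    rw [yOutput, Function.comp_apply, φ.left_inv hY, hg.yPart_eq]
  solves := by
    filter_upwards [hg.smooth.eventually, hg.eventually_mem_source hξ₀, hg.solves]
      with Y hgY hY hsolves
    have hφY : ContDiffAt ℝ ∞ φ (g Y) := hφ.contDiffAt (φ.open_source.mem_nhds hY)
    exact (hT.forall_lhs_derivAlong_eq_zero_iff hgY hY (hφY.differentiableAt (by simp))).1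
      fun i => hsolves i (Fin.le_last _)

end IsBlockParametrization

theorem exists_isBlockParametrization (hf : ContDiffOn ℝ ∞ f φ.target)
    (hφ : ContDiffOn ℝ ∞ φ φ.source) (hφsymm : ContDiffOn ℝ ∞ φ.symm φ.target)
    (hT : Represents T φ f) (hξ₀ : Jet.base ξ₀ ∈ φ.target)
    (hreg : T.RegularAt (φ.symm (Jet.base ξ₀))
      (fderiv ℝ φ.symm (Jet.base ξ₀) (f (Jet.base ξ₀), ξ₀.2 1))) (n : Fin (B.nb + 1)) :
    ∃ g, IsBlockParametrization f φ T ξ₀ n g := by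
  induction n using Fin.induction with
  | zero => exact exists_isBlockParametrization_zero f T ξ₀
  | succ i ih =>
    obtain ⟨g, hg⟩ := ih
    obtain ⟨ψ, hψ⟩ := hg.exists_isHatSolutionAt hf hφ hφsymm hT hξ₀ (hreg i)
    exact ⟨_, hg.solveBlock hf hφ hφsymm hT hξ₀ hψ⟩

theorem isFlatOutputAt_yOutput (hcard : Fintype.card B.YIndex = nu)
    (hf : ContDiffOn ℝ ∞ f φ.target) (hφ : ContDiffOn ℝ ∞ φ φ.source)
    (hφsymm : ContDiffOn ℝ ∞ φ.symm φ.target) (hT : Represents T φ f)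
    (hξ₀ : Jet.base ξ₀ ∈ φ.target)
    (hreg : T.RegularAt (φ.symm (Jet.base ξ₀))
      (fderiv ℝ φ.symm (Jet.base ξ₀) (f (Jet.base ξ₀), ξ₀.2 1))) :
    IsFlatOutputAt f (yOutput φ) ξ₀ := by
  obtain ⟨g, hg⟩ := exists_isBlockParametrization hf hφ hφsymm hT hξ₀ hreg (Fin.last B.nb)
  have hbase : ∀ᶠ ξ in 𝓝 ξ₀, (φ ∘ g) (outputJet f (yOutput φ) ξ) = Jet.base ξ := by
    filter_upwards [hg.agrees, eventually_base_mem_target hξ₀] with ξ hagrees hξ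
    have hgξ : g (outputJet f (yOutput φ) ξ) = φ.symm (Jet.base ξ) :=
      funext fun κ => hagrees κ (Fin.le_last _)
    rw [Function.comp_apply, hgξ, φ.right_inv hξ]
  exact isFlatOutputAt_of_isParametrizationAt hcard
    (eventually_contDiffAt_of_contDiffOn hf φ.open_target hξ₀)
    (eventually_contDiffAt_yOutput hφsymm hξ₀) (hg.isParametrizationAt hφ hT hξ₀) hbase

end BlockParametrization

theorem IsFlatOutputAt.reindex {nx nu : ℕ} {ι ι' : Type} [Fintype ι] [Fintype ι']
    {f : StateInput nx nu → Fin nx → ℝ} {h : StateInput nx nu → ι → ℝ} {ξ₀ : Jet nx nu}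
    (hh : IsFlatOutputAt f h ξ₀) (e : ι' ≃ ι) : IsFlatOutputAt f (fun p i => h p (e i)) ξ₀ := by
  obtain ⟨hcard, ⟨W, hW, hξ₀W, hhW⟩, N, hN, hξ₀N, hindep, r, V, F, hV, hF, hFV⟩ := hh
  have hrelabel : ContDiff ℝ ∞ fun (y : Fin (r + 1) → ι' → ℝ) k i => y k (e.symm i) := by
    fun_prop
  have hderiv (ξ : Jet nx nu) : (fun (k : Fin (r + 1)) (i : ι) =>
      outputDeriv f (fun p i' => h p (e i')) k (e.symm i) ξ) =
      fun (k : Fin (r + 1)) (i : ι) => outputDeriv f h k i ξ := by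
    funext k i
    conv_rhs => rw [← e.apply_symm_apply i]
    rfl
  refine ⟨(Fintype.card_congr e).trans hcard, ⟨W, hW, hξ₀W, ?_⟩, N, hN, hξ₀N, fun ξ hξ => ?_,
    r, (fun y k i => y k (e.symm i)) ⁻¹' V, fun y => F fun k i => y k (e.symm i),
    hV.preimage hrelabel.continuous, hF.comp hrelabel.contDiffOn fun y hy => hy, fun ξ hξ => ?_⟩
  · exact contDiffOn_pi.2 fun i => contDiffOn_pi.1 hhW (e i)
  · exact (hindep ξ hξ).comp (Prod.map id e) (Function.injective_id.prodMap e.injective)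
  · simpa only [Set.mem_preimage, hderiv] using hFV ξ hξ

theorem card_yIndex (B : BlockPartition) :
    Fintype.card B.YIndex = ∑ i : Fin B.nb, B.ny i.castSucc := by
  simp [Fin.sum_univ_castSucc, B.ny_last]

end ControlFlat

end

theorem mainTheorem2 {nx nu : ℕ}
    -- a smooth control system on an open set of the `(x,u)`-space
    (Ω : Set (ControlFlat.StateInput nx nu)) (hΩ : IsOpen Ω)
    (f : ControlFlat.StateInput nx nu → Fin nx → ℝ) (hf : ContDiffOn ℝ ∞ f Ω)
    -- the jet near which we work
    (ξ₀ : ControlFlat.Jet nx nu)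
    -- the blocks of `z`
    (B : ControlFlat.BlockPartition)
    (hnz : ∑ i, B.nz i = nx + nu)
    (hny : ∑ i : Fin B.nb, B.ny i.castSucc = nu)
    -- the local diffeomorphism `(x,u) = φ(z)`
    (φ : OpenPartialHomeomorph B.Coord (ControlFlat.StateInput nx nu))
    (hφ : ContDiffOn ℝ ∞ φ φ.source) (hφsymm : ContDiffOn ℝ ∞ φ.symm φ.target)
    (hφΩ : φ.target ⊆ Ω) (hξ₀ : ControlFlat.Jet.base ξ₀ ∈ φ.target)
    -- the implicit triangular form, regular at the values of `z` and `ż` given by `ξ₀`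
    (T : ControlFlat.TriangularEquations B φ.source)
    (hT : ControlFlat.Represents T φ f)
    (hreg : T.RegularAt (φ.symm (ControlFlat.Jet.base ξ₀))
      (fderiv ℝ φ.symm (ControlFlat.Jet.base ξ₀) (f (ControlFlat.Jet.base ξ₀), ξ₀.2 1))) :
    ControlFlat.IsOneFlatAt f ξ₀ ∧
      ControlFlat.IsFlatOutputAt f (fun p => B.yPart (φ.symm p)) ξ₀ := by
  have hf' : ContDiffOn ℝ ∞ f φ.target := hf.mono hφΩ
  have hcard : Fintype.card B.YIndex = nu := (ControlFlat.card_yIndex B).trans hny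
  have h := ControlFlat.isFlatOutputAt_yOutput hcard hf' hφ hφsymm hT hξ₀ hreg
  exact ⟨⟨_, h.reindex (Fintype.equivFinOfCardEq hcard).symm⟩, h⟩
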